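/- Let $\Delta$ be the space of pairs $(f,h)$ of probability measures on $\mathbb N=\{0,1,2,\dots\}$ with the total variation metric, let $\mathbf Q=(f,h)$ be a random element of $\Delta$, and let $\mathbf Q_n=(f_n,h_n)$, $n\ge1$, be independent copies of $\mathbf Q$; put $\xi=(\mathbf Q_1,\mathbf Q_2,\dots)$. (For a fixed $n$, $f_n$ and $h_n$ may be dependent.) Let $(Z_n)_{n\ge0}$ be a branching process with immigration in the random environment $\xi$: $Z_0=k\ge1$ and, given $\xi$, $(Z_n)$ is an $\mathbb N$-valued Markov chain such that for $n\ge1$, given $Z_{n-1}=z$, $Z_n$ has the law of $N_{n,1}+\dots+N_{n,z}+Y_n$, where $N_{n,1},\dots,N_{n,z},Y_n$ are independent, each $N_{n,i}$ has law $f_n$, and $Y_n$ has law $h_n$. Write $\mathbb P_k$ for the annealed probability (averaged over $\xi$) when $Z_0=k$, and $m_1=\sum_{j\ge0} j f_1(\{j\})$. Suppose that $0<m_1<\infty$ a.s., that $\mathbb E\log m_1\in(0,\infty)$, and that $\mathbb P(h(\{0\})<1)>0$. Suppose moreover that (A) $\mathbb P\big(h(\{0\})>0,\ f(\{0\})>0,\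 f(\{1\})>0\big)>0$; (B) there is a constant $\delta\in(0,1)$ with $f(\{0\})<\delta$ a.s. Then there are $\theta\in(0,\mathbb E\log m_1)$, $\beta>0$ and $C>0$, depending only on the law of $\mathbf Q$, such that for all $k\ge1$ and all $n\ge0$, $$\mathbb P_k\big(1\le Z_n\le e^{\theta n}\big)\le C e^{-\beta n}.$$ -/

import Mathlib

open MeasureTheory ProbabilityTheory
open scoped ENNReal

namespace BPIRE

/-- The space of pairs `(f, h)` of probability measures on `ℕ`: `f` is an offspring law and `h` is
an immigration law. It carries the product of the evaluation σ-algebras, which on probability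
measures on `ℕ` is the Borel σ-algebra of the total variation metric. -/
abbrev Env : Type := ProbabilityMeasure ℕ × ProbabilityMeasure ℕ

/-- The mean `∑ j, j * f {j}` of a probability measure on `ℕ`, as an extended real. -/
noncomputable def mean (f : ProbabilityMeasure ℕ) : ℝ≥0∞ :=
  ∑' j : ℕ, (j : ℝ≥0∞) * (f : Measure ℕ) {j}

/-- The increment `log m(f)` of the associated random walk. -/
noncomputable def logMean (q : Env) : ℝ := Real.log (mean q.1).toReal

/-- The law of `N₁ + ⋯ + N_z + Y`, where `N₁, …, N_z, Y` are independent, each `Nᵢ` has law `q.1`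
and `Y` has law `q.2`. -/
noncomputable def stepLaw (q : Env) (z : ℕ) : Measure ℕ :=
  ((Measure.pi fun _ : Fin z => (q.1 : Measure ℕ)).prod (q.2 : Measure ℕ)).map
    fun p => (∑ i, p.1 i) + p.2

/-- The σ-algebra generated by the whole environment `ξ` and by `Z 0, …, Z n`. -/
abbrev history {Ω : Type*} (ξ : ℕ → Ω → Env) (Z : ℕ → Ω → ℕ) (n : ℕ) : MeasurableSpace Ω :=
  (⨆ m : ℕ, MeasurableSpace.comap (ξ m) inferInstance) ⊔
    ⨆ i ∈ Finset.range (n + 1), MeasurableSpace.comap (Z i) inferInstance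

/-- `Z` is a branching process with immigration in the i.i.d. random environment `ξ`, whose
one-step law is `ν`, started with `k` individuals. The variable `ξ n` is the pair of the offspring
law of generation `n` and of the law of the number of immigrants of generation `n + 1`.
Given the whole environment, `Z` is a Markov chain with transition laws `stepLaw (ξ n)`. -/
structure IsBPIRE {Ω : Type*} [MeasurableSpace Ω] (P : Measure Ω) (ν : Measure Env) (k : ℕ)
    (ξ : ℕ → Ω → Env) (Z : ℕ → Ω → ℕ) : Prop where
  measurable_env : ∀ n, Measurable (ξ n)
  measurable_process : ∀ n, Measurable (Z n)
  indep_env : iIndepFun ξ P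
  law_env : ∀ n, P.map (ξ n) = ν
  init : ∀ᵐ ω ∂P, Z 0 ω = k
  markov : ∀ n j : ℕ, P⟦Z (n + 1) ⁻¹' {j} | history ξ Z n⟧
    =ᵐ[P] fun ω => (stepLaw (ξ n ω) (Z n ω)).real {j}

/-- Standing hypotheses on the law `ν` of the pair `(f, h)`: the offspring mean is a.s. positive
and finite, `E log m(f)` exists and lies in `(0, ∞)`, and immigration is not degenerate. -/
structure Supercritical (ν : Measure Env) : Prop where
  mean_pos_finite : ∀ᵐ q ∂ν, 0 < mean q.1 ∧ mean q.1 < ∞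
  integrable_logMean : Integrable logMean ν
  integral_logMean_pos : 0 < ∫ q, logMean q ∂ν
  immigration : 0 < ν {q | (q.2 : Measure ℕ) {0} < 1}

/-- With positive probability, `h {0}`, `f {0}` and `f {1}` are all positive. -/
def AssumptionA (ν : Measure Env) : Prop :=
  0 < ν {q | 0 < (q.2 : Measure ℕ) {0} ∧ 0 < (q.1 : Measure ℕ) {0} ∧ 0 < (q.1 : Measure ℕ) {1}}

/-- For some deterministic `δ ∈ (0, 1)`, almost surely `f {0} < δ`. -/
def AssumptionB (ν : Measure Env) : Prop :=
  ∃ δ : ℝ, 0 < δ ∧ δ < 1 ∧ ∀ᵐ q ∂ν, (q.1 : Measure ℕ).real {0} < δ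

end BPIRE

/-!
# Exponential lower deviations of a supercritical branching process with immigration

Averaged over the environment, `Z` is a Markov chain on `ℕ` (`IsBPIRE.lintegral_succ`): the state at
time `n` is independent of the environments which drive the later steps. The estimate follows from
a potential `V z = max 1 (z / b) ^ (-ε)` (`potential`) and the annealed transition operator `T`
(`transition`), as soon as some iterate `T^[L] V` is at most `ρ * V` with `ρ < 1`. Indeed the mean
of `V (Z n)` is then at most `ρ ^ (n / L)`, whereas `V (Z n) ≥ exp (-ε θ n)` if `Z n ≤ exp (θ n)`, and
Markov's inequality gives the bound for small `θ`. As `V ≤ 1`, the estimate is uniform in `Z 0`.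

The contraction of `V` has two sources.

* Above the level `b` one step suffices (`Supercritical.exists_potential_drift`). As `f {0}` stays
  away from `1`, `log m(f)` is bounded below, and truncating the offspring numbers at a large `M`
  preserves the positivity of the mean of the logarithm (`Supercritical.exists_truncMean`). The
  truncated offspring numbers have uniformly bounded variance, so by Chebyshev's inequality the
  population grows essentially by the factor `m_M(f)`, except with probability `O(1 / z)`. Since
  `log m_M(f)` is bounded with positive mean, `m_M(f) ^ (-ε)` has mean less than `1` for small `ε`.
* Below `b` there are only finitely many states, and from each of them the chain is above `b` after
  `b + 1` steps with positive probability, thanks to the immigration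
  (`Supercritical.iterate_transition_lt_one`).

This argument bounds the probability of `Z n ≤ exp (θ n)`, the event `Z n = 0` included.
-/

namespace BPIRE

/-! ### The annealed Markov chain -/

lemma measurable_eval_fst (s : Set ℕ) : Measurable fun q : Env => (q.1 : Measure ℕ) s :=
  (Measure.measurable_coe (MeasurableSet.of_discrete (s := s))).comp
    (measurable_subtype_coe.comp measurable_fst)

lemma measurable_eval_snd (s : Set ℕ) : Measurable fun q : Env => (q.2 : Measure ℕ) s :=
  (Measure.measurable_coe (MeasurableSet.of_discrete (s := s))).comp
    (measurable_subtype_coe.comp measurable_snd)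

lemma stepLaw_apply (q : Env) (z : ℕ) (s : Set ℕ) :
    stepLaw q z s = ((Measure.pi fun _ : Fin z => (q.1 : Measure ℕ)).prod (q.2 : Measure ℕ))
      {p | (∑ i, p.1 i) + p.2 ∈ s} :=
  Measure.map_apply (measurable_of_countable _) .of_discrete

instance (q : Env) (z : ℕ) : IsProbabilityMeasure (stepLaw q z) :=
  Measure.isProbabilityMeasure_map (measurable_of_countable _).aemeasurable

lemma measurable_stepLaw_apply (z : ℕ) (s : Set ℕ) : Measurable fun q : Env => stepLaw q z s := by
  have h : ∀ q : Env, stepLaw q z s = ∑' p : (Fin z → ℕ) × ℕ,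
      Set.indicator {p : (Fin z → ℕ) × ℕ | (∑ i, p.1 i) + p.2 ∈ s}
        (fun p => (∏ i, (q.1 : Measure ℕ) {p.1 i}) * (q.2 : Measure ℕ) {p.2}) p := by
    intro q
    rw [stepLaw_apply, ← Measure.tsum_indicator_apply_singleton _ _ .of_discrete]
    refine tsum_congr fun p => ?_
    congr 1
    ext p
    rw [← Set.singleton_prod_singleton, Measure.prod_prod, Measure.pi_singleton]
  simp_rw [h]
  refine Measurable.tsum fun p => ?_
  by_cases hp : p ∈ {p : (Fin z → ℕ) × ℕ | (∑ i, p.1 i) + p.2 ∈ s}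
  · simp only [Set.indicator_of_mem hp]
    exact (Finset.measurable_fun_prod _ fun i _ => measurable_eval_fst _).mul
      (measurable_eval_snd _)
  · simp only [Set.indicator_of_notMem hp]
    exact measurable_const

/-- The transition operator of the annealed process: `transition ν V z` is the mean of `V` after one
step from `z`, averaged over the environment of that step. -/
noncomputable def transition (ν : Measure Env) (V : ℕ → ℝ≥0∞) (z : ℕ) : ℝ≥0∞ :=
  ∫⁻ q, ∫⁻ j, V j ∂(stepLaw q z) ∂ν

lemma transition_eq_tsum (ν : Measure Env) (V : ℕ → ℝ≥0∞) (z : ℕ) :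
    transition ν V z = ∑' j, V j * ∫⁻ q, stepLaw q z {j} ∂ν := by
  simp_rw [transition, lintegral_countable']
  rw [lintegral_tsum fun j => ((measurable_stepLaw_apply z {j}).const_mul _).aemeasurable]
  exact tsum_congr fun j => lintegral_const_mul _ (measurable_stepLaw_apply z {j})

lemma transition_mono (ν : Measure Env) : Monotone (transition ν) := fun _ _ h _ =>
  lintegral_mono fun _ => lintegral_mono h

section Chain

/-- The σ-algebra generated by the environments `ξ m` with `n ≤ m`. -/
abbrev future {Ω : Type*} (ξ : ℕ → Ω → Env) (n : ℕ) : MeasurableSpace Ω :=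
  ⨆ m ∈ Set.Ici n, MeasurableSpace.comap (ξ m) inferInstance

lemma future_le_history {Ω : Type*} (ξ : ℕ → Ω → Env) (Z : ℕ → Ω → ℕ) (n m : ℕ) :
    future ξ m ≤ history ξ Z n :=
  le_trans (iSup₂_le fun i _ => le_iSup (fun m => MeasurableSpace.comap (ξ m) inferInstance) i)
    le_sup_left

variable {Ω : Type*} [MeasurableSpace Ω] {P : Measure Ω}
  {ν : Measure Env} {k : ℕ} {ξ : ℕ → Ω → Env} {Z : ℕ → Ω → ℕ}

lemma IsBPIRE.future_le (h : IsBPIRE P ν k ξ Z) (n : ℕ) : future ξ n ≤ ‹MeasurableSpace Ω› :=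
  iSup₂_le fun m _ => (h.measurable_env m).comap_le

lemma IsBPIRE.history_le (h : IsBPIRE P ν k ξ Z) (n : ℕ) : history ξ Z n ≤ ‹MeasurableSpace Ω› :=
  sup_le (iSup_le fun m => (h.measurable_env m).comap_le)
    (iSup₂_le fun i _ => (h.measurable_process i).comap_le)

lemma lintegral_comp_eq_tsum {X : Ω → ℕ} (hX : Measurable X) (V : ℕ → ℝ≥0∞) :
    ∫⁻ ω, V (X ω) ∂P = ∑' j, V j * P (X ⁻¹' {j}) := by
  rw [← lintegral_map (measurable_of_countable V) hX, lintegral_countable']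
  exact tsum_congr fun j => by rw [Measure.map_apply hX .of_discrete]

variable [IsProbabilityMeasure P]

/-- The Markov property, integrated over an event on which the present state is known. -/
lemma IsBPIRE.measure_step (h : IsBPIRE P ν k ξ Z) (n i j : ℕ) {S : Set Ω}
    (hS : MeasurableSet[future ξ (n + 1)] S) :
    P (Z (n + 1) ⁻¹' {j} ∩ (Z n ⁻¹' {i} ∩ S)) =
      ∫⁻ ω in Z n ⁻¹' {i} ∩ S, stepLaw (ξ n ω) i {j} ∂P := by
  set T := Z n ⁻¹' {i} ∩ S
  have hTm : MeasurableSet[history ξ Z n] T := by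
    refine MeasurableSet.inter ?_ (future_le_history ξ Z n (n + 1) S hS)
    have hle : MeasurableSpace.comap (Z n) inferInstance ≤ history ξ Z n :=
      le_sup_of_le_right (le_iSup₂_of_le (f := fun i (_ : i ∈ Finset.range (n + 1)) =>
        MeasurableSpace.comap (Z i) inferInstance) n (by simp) le_rfl)
    exact hle _ ⟨{i}, .of_discrete, rfl⟩
  have hTm' : MeasurableSet T := h.history_le n T hTm
  have hj : MeasurableSet (Z (n + 1) ⁻¹' {j}) := h.measurable_process (n + 1) .of_discrete
  have hmeas : Measurable fun ω => stepLaw (ξ n ω) i {j} :=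
    (measurable_stepLaw_apply i {j}).comp (h.measurable_env n)
  have h1 : P.real (Z (n + 1) ⁻¹' {j} ∩ T) = ∫ ω in T, (stepLaw (ξ n ω) i {j}).toReal ∂P := by
    calc P.real (Z (n + 1) ⁻¹' {j} ∩ T)
        = ∫ ω in T, (Z (n + 1) ⁻¹' {j}).indicator (fun _ => (1 : ℝ)) ω ∂P := by
          rw [integral_indicator_const _ hj, measureReal_restrict_apply hj]; simp
      _ = ∫ ω in T, (P⟦Z (n + 1) ⁻¹' {j} | history ξ Z n⟧) ω ∂P :=
          (setIntegral_condExp (h.history_le n)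
            ((integrable_const (1 : ℝ)).indicator hj) hTm).symm
      _ = ∫ ω in T, (stepLaw (ξ n ω) (Z n ω)).real {j} ∂P :=
          setIntegral_congr_ae hTm' ((h.markov n j).mono fun ω hω _ => hω)
      _ = ∫ ω in T, (stepLaw (ξ n ω) i {j}).toReal ∂P :=
          setIntegral_congr_fun hTm' fun ω hω => by
            have : Z n ω = i := hω.1
            simp only [this, Measure.real]
  rw [integral_toReal hmeas.aemeasurable (ae_of_all _ fun ω => measure_lt_top _ _)] at h1
  refine (ENNReal.toReal_eq_toReal_iff' (measure_ne_top _ _) ?_).mp h1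
  refine ne_top_of_le_ne_top (measure_ne_top P T) ?_
  calc ∫⁻ ω in T, stepLaw (ξ n ω) i {j} ∂P ≤ ∫⁻ _ in T, 1 ∂P :=
        lintegral_mono fun ω => prob_le_one
    _ = P T := by simp

/-- If the present state is independent of the future environments, then the state after one more
step is distributed according to the annealed transition and is independent of the environments
which come after it. -/
lemma IsBPIRE.measure_step_of_indep (h : IsBPIRE P ν k ξ Z) (n : ℕ)
    (hind : ∀ i S, MeasurableSet[future ξ n] S → P (Z n ⁻¹' {i} ∩ S) = P (Z n ⁻¹' {i}) * P S)
    (j : ℕ) {S : Set Ω} (hS : MeasurableSet[future ξ (n + 1)] S) :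
    P (Z (n + 1) ⁻¹' {j} ∩ S) =
      (∑' i, P (Z n ⁻¹' {i}) * ∫⁻ q, stepLaw q i {j} ∂ν) * P S := by
  have hS' : MeasurableSet S := h.future_le _ S hS
  have hfle : future ξ (n + 1) ≤ future ξ n :=
    biSup_mono fun m hm => (Nat.le_succ n).trans hm
  have hξle : MeasurableSpace.comap (ξ n) inferInstance ≤ future ξ n :=
    le_iSup₂_of_le (f := fun m (_ : m ∈ Set.Ici n) => MeasurableSpace.comap (ξ m) inferInstance)
      n (Set.mem_Ici.2 le_rfl) le_rfl
  -- Splitting along the value of `Z n`.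
  have hsplit : P (Z (n + 1) ⁻¹' {j} ∩ S) =
      ∑' i, P (Z (n + 1) ⁻¹' {j} ∩ (Z n ⁻¹' {i} ∩ S)) := by
    rw [← measure_iUnion]
    · congr 1
      ext ω
      simp
    · intro a b hab
      refine Set.disjoint_left.2 fun ω ha hb => hab ?_
      exact (ha.2.1 : Z n ω = a).symm.trans hb.2.1
    · intro i
      exact (h.measurable_process _ .of_discrete).inter
        ((h.measurable_process _ .of_discrete).inter hS')
  rw [hsplit, ← ENNReal.tsum_mul_right]
  refine tsum_congr fun i => ?_
  rw [h.measure_step n i j hS]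
  set g : Ω → ℝ≥0∞ := S.indicator fun ω => stepLaw (ξ n ω) i {j} with hg
  have hsm : Measurable[future ξ n] fun ω => stepLaw (ξ n ω) i {j} :=
    ((measurable_stepLaw_apply i {j}).comp (comap_measurable (ξ n))).mono hξle le_rfl
  have hgm : Measurable[future ξ n] g := hsm.indicator (hfle S hS)
  -- On the future σ-algebra, restricting `P` to `Z n = i` amounts to scaling it.
  have hrestr : (P.restrict (Z n ⁻¹' {i})).trim (h.future_le n) =
      (P (Z n ⁻¹' {i}) • P).trim (h.future_le n) := by
    refine @Measure.ext Ω (future ξ n) _ _ fun A hA => ?_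
    rw [trim_measurableSet_eq _ hA, trim_measurableSet_eq _ hA,
      Measure.restrict_apply (h.future_le n A hA), Set.inter_comm, hind i A hA]
    simp
  have h1 : ∫⁻ ω in Z n ⁻¹' {i} ∩ S, stepLaw (ξ n ω) i {j} ∂P =
      P (Z n ⁻¹' {i}) * ∫⁻ ω, g ω ∂P := by
    rw [Set.inter_comm, ← Measure.restrict_restrict hS', ← lintegral_indicator hS',
      ← lintegral_trim (h.future_le n) hgm, hrestr, lintegral_trim (h.future_le n) hgm,
      lintegral_smul_measure, smul_eq_mul]
  have hindep : Indep (MeasurableSpace.comap (ξ n) inferInstance) (future ξ (n + 1)) P := by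
    have := indep_iSup_of_disjoint (fun m => (h.measurable_env m).comap_le) h.indep_env
      (S := {n}) (T := Set.Ici (n + 1)) (by simp)
    rwa [iSup_singleton] at this
  have h2 : ∫⁻ ω, g ω ∂P = (∫⁻ q, stepLaw q i {j} ∂ν) * P S := by
    have := lintegral_mul_eq_lintegral_mul_lintegral_of_independent_measurableSpace
      (h.measurable_env n).comap_le (h.future_le (n + 1)) hindep
      ((measurable_stepLaw_apply i {j}).comp (comap_measurable (ξ n)))
      (Measurable.indicator (measurable_const (a := (1 : ℝ≥0∞))) hS)
    rw [← h.law_env n, lintegral_map (measurable_stepLaw_apply i {j}) (h.measurable_env n)]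
    rw [lintegral_indicator hS', lintegral_one, Measure.restrict_apply_univ] at this
    refine Eq.trans ?_ this
    refine lintegral_congr fun ω => ?_
    by_cases hω : ω ∈ S <;> simp [hg, hω]
  rw [h1, h2, mul_assoc]

/-- The state at time `n` is independent of the environments of the generations from `n` on. -/
lemma IsBPIRE.indep_future (h : IsBPIRE P ν k ξ Z) (n i : ℕ) {S : Set Ω}
    (hS : MeasurableSet[future ξ n] S) : P (Z n ⁻¹' {i} ∩ S) = P (Z n ⁻¹' {i}) * P S := by
  induction n generalizing i S with
  | zero =>
    by_cases hi : i = k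
    · have h1 : P (Z 0 ⁻¹' {i}) = 1 := by
        rw [← mem_ae_iff_prob_eq_one (h.measurable_process 0 .of_discrete)]
        filter_upwards [h.init] with ω hω
        exact hω.trans hi.symm
      have h2 : (Z 0 ⁻¹' {i} ∩ S : Set Ω) =ᵐ[P] S := by
        filter_upwards [h.init] with ω hω
        exact propext ⟨fun hh => hh.2, fun hh => ⟨hω.trans hi.symm, hh⟩⟩
      rw [h1, one_mul, measure_congr h2]
    · have h1 : P (Z 0 ⁻¹' {i}) = 0 := by
        refine measure_mono_null (t := {ω | ¬ Z 0 ω = k}) (fun ω hω => ?_) h.init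
        have : Z 0 ω = i := hω
        simpa [this] using hi
      rw [h1, zero_mul]
      exact measure_mono_null Set.inter_subset_left h1
  | succ n ih =>
    rw [h.measure_step_of_indep n (fun i S hS => ih i hS) i hS]
    congr 1
    have := h.measure_step_of_indep n (fun i S hS => ih i hS) i
      (MeasurableSet.univ (α := Ω) (m := future ξ (n + 1)))
    simpa using this.symm

/-- The annealed process is a Markov chain with transition operator `transition ν`. -/
lemma IsBPIRE.lintegral_succ (h : IsBPIRE P ν k ξ Z) (V : ℕ → ℝ≥0∞) (n : ℕ) :
    ∫⁻ ω, V (Z (n + 1) ω) ∂P = ∫⁻ ω, transition ν V (Z n ω) ∂P := by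
  have hstep : ∀ j, P (Z (n + 1) ⁻¹' {j}) =
      ∑' i, P (Z n ⁻¹' {i}) * ∫⁻ q, stepLaw q i {j} ∂ν := fun j => by
    simpa using h.measure_step_of_indep n (fun i S hS => h.indep_future n i hS) j
      (MeasurableSet.univ (α := Ω) (m := future ξ (n + 1)))
  rw [lintegral_comp_eq_tsum (h.measurable_process _),
    lintegral_comp_eq_tsum (h.measurable_process _)]
  simp_rw [hstep, transition_eq_tsum, ← ENNReal.tsum_mul_left, ← ENNReal.tsum_mul_right]
  rw [ENNReal.tsum_comm]
  exact tsum_congr fun i => tsum_congr fun j => by ring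

lemma IsBPIRE.lintegral_add (h : IsBPIRE P ν k ξ Z) (V : ℕ → ℝ≥0∞) (n m : ℕ) :
    ∫⁻ ω, V (Z (n + m) ω) ∂P = ∫⁻ ω, (transition ν)^[m] V (Z n ω) ∂P := by
  induction m generalizing V with
  | zero => rfl
  | succ m ih => rw [← add_assoc, h.lintegral_succ, ih, Function.iterate_succ_apply]

end Chain

/-! ### Truncated offspring means -/

/-- The mean of the offspring law `q.1` truncated at `M`, that is, the mean of `min N M`. -/
noncomputable def truncMean (M : ℕ) (q : Env) : ℝ := ∫ j, ((min j M : ℕ) : ℝ) ∂(q.1 : Measure ℕ)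

lemma norm_cast_min_le (j M : ℕ) : ‖((min j M : ℕ) : ℝ)‖ ≤ M := by
  rw [Real.norm_of_nonneg (Nat.cast_nonneg _)]
  exact Nat.cast_le.2 (min_le_right j M)

lemma integrable_min (μ : Measure ℕ) [IsFiniteMeasure μ] (M : ℕ) :
    Integrable (fun j : ℕ => ((min j M : ℕ) : ℝ)) μ :=
  Integrable.of_bound (measurable_of_countable _).aestronglyMeasurable (M : ℝ)
    (ae_of_all _ fun j => norm_cast_min_le j M)

lemma measurable_truncMean (M : ℕ) : Measurable (truncMean M) := by
  have h : truncMean M = fun q : Env =>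
      (∫⁻ j, ENNReal.ofReal ((min j M : ℕ) : ℝ) ∂(q.1 : Measure ℕ)).toReal := by
    ext q
    exact integral_eq_lintegral_of_nonneg_ae (ae_of_all _ fun j => Nat.cast_nonneg _)
      (measurable_of_countable _).aestronglyMeasurable
  rw [h]
  exact ((Measure.measurable_lintegral (measurable_of_countable _)).comp
    (measurable_subtype_coe.comp measurable_fst)).ennreal_toReal

lemma truncMean_le (M : ℕ) (q : Env) : truncMean M q ≤ M := by
  calc truncMean M q ≤ ∫ _, (M : ℝ) ∂(q.1 : Measure ℕ) :=
        integral_mono (integrable_min _ M) (integrable_const _) fun j =>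
          Nat.cast_le.2 (min_le_right j M)
    _ = M := by simp

lemma one_sub_measure_zero_le_truncMean {M : ℕ} (hM : 1 ≤ M) (q : Env) :
    1 - (q.1 : Measure ℕ).real {0} ≤ truncMean M q := by
  calc 1 - (q.1 : Measure ℕ).real {0} = (q.1 : Measure ℕ).real {0}ᶜ :=
        (probReal_compl_eq_one_sub .of_discrete).symm
    _ = ∫ j, ({0}ᶜ : Set ℕ).indicator (fun _ => (1 : ℝ)) j ∂(q.1 : Measure ℕ) := by
        rw [integral_indicator_const _ .of_discrete]; simp
    _ ≤ truncMean M q := by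
        refine integral_mono ((integrable_const _).indicator .of_discrete) (integrable_min _ M)
          fun j => ?_
        by_cases hj : j = 0
        · simp [hj]
        · have : 1 ≤ min j M := le_min (Nat.one_le_iff_ne_zero.2 hj) hM
          simp only [Set.indicator, Set.mem_compl_iff, Set.mem_singleton_iff, hj,
            not_false_eq_true, if_true]
          exact_mod_cast this

lemma mean_eq_lintegral (f : ProbabilityMeasure ℕ) : mean f = ∫⁻ j, (j : ℝ≥0∞) ∂(f : Measure ℕ) :=
  (lintegral_countable' _).symm

lemma integrable_natCast {q : Env} (hq : mean q.1 < ∞) :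
    Integrable (fun j : ℕ => (j : ℝ)) (q.1 : Measure ℕ) := by
  refine ⟨(measurable_of_countable _).aestronglyMeasurable, ?_⟩
  rw [hasFiniteIntegral_iff_ofReal (ae_of_all _ fun j => Nat.cast_nonneg j)]
  simpa [mean_eq_lintegral] using hq

lemma toReal_mean (q : Env) : (mean q.1).toReal = ∫ j, (j : ℝ) ∂(q.1 : Measure ℕ) := by
  rw [integral_eq_lintegral_of_nonneg_ae (ae_of_all _ fun j => Nat.cast_nonneg j)
    (measurable_of_countable _).aestronglyMeasurable]
  simp [mean_eq_lintegral]

lemma truncMean_le_toReal_mean (M : ℕ) {q : Env} (hq : mean q.1 < ∞) :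
    truncMean M q ≤ (mean q.1).toReal := by
  rw [toReal_mean]
  exact integral_mono (integrable_min _ M) (integrable_natCast hq) fun j =>
    Nat.cast_le.2 (min_le_left j M)

lemma tendsto_truncMean {q : Env} (hq : mean q.1 < ∞) :
    Filter.Tendsto (fun M => truncMean M q) Filter.atTop (nhds (mean q.1).toReal) := by
  rw [toReal_mean]
  refine tendsto_integral_of_dominated_convergence (fun j => (j : ℝ))
    (fun M => (measurable_of_countable _).aestronglyMeasurable) (integrable_natCast hq)
    (fun M => ae_of_all _ fun j => by
      rw [Real.norm_of_nonneg (Nat.cast_nonneg _)]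
      exact Nat.cast_le.2 (min_le_left j M)) (ae_of_all _ fun j => ?_)
  refine tendsto_const_nhds.congr' ?_
  filter_upwards [Filter.eventually_ge_atTop j] with M hM
  rw [min_eq_left hM]

/-- Since `f {0}` stays away from `1`, the logarithms of the truncated means are bounded below, and
they increase to `log m(f)`. Hence some truncation is still supercritical. -/
lemma Supercritical.exists_truncMean {ν : Measure Env} [IsProbabilityMeasure ν]
    (hν : Supercritical ν) {δ : ℝ} (hδ : δ < 1) (hB : ∀ᵐ q ∂ν, (q.1 : Measure ℕ).real {0} < δ) :
    ∃ M : ℕ, 1 ≤ M ∧ 0 < ∫ q, Real.log (truncMean M q) ∂ν := by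
  have hlim : Filter.Tendsto (fun M => ∫ q, Real.log (truncMean (M + 1) q) ∂ν) Filter.atTop
      (nhds (∫ q, logMean q ∂ν)) := by
    refine tendsto_integral_of_dominated_convergence
      (fun q => |Real.log (1 - δ)| + |logMean q|)
      (fun M => (measurable_truncMean _).log.aestronglyMeasurable)
      ((integrable_const _).add hν.integrable_logMean.abs) (fun M => ?_) ?_
    · filter_upwards [hν.mean_pos_finite, hB] with q hq hq0
      have h1 := one_sub_measure_zero_le_truncMean (M := M + 1) (by omega) q
      have h2 := truncMean_le_toReal_mean (M + 1) hq.2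
      have h3 : Real.log (1 - δ) ≤ Real.log (truncMean (M + 1) q) :=
        Real.log_le_log (by linarith) (by linarith)
      have h4 : Real.log (truncMean (M + 1) q) ≤ logMean q :=
        Real.log_le_log (by linarith) h2
      rw [Real.norm_eq_abs, abs_le]
      constructor
      · linarith [neg_abs_le (Real.log (1 - δ)), abs_nonneg (logMean q)]
      · linarith [le_abs_self (logMean q), abs_nonneg (Real.log (1 - δ))]
    · filter_upwards [hν.mean_pos_finite] with q hq
      exact ((tendsto_truncMean hq.2).comp (Filter.tendsto_add_atTop_nat 1)).log
        (ENNReal.toReal_pos hq.1.ne' hq.2.ne).ne'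
  obtain ⟨M, hM⟩ := (hlim.eventually (lt_mem_nhds hν.integral_logMean_pos)).exists
  exact ⟨M + 1, by omega, hM⟩

/-- A bounded random variable with positive mean has a negative exponential moment below `1`. -/
lemma exists_lintegral_exp_lt_one {α : Type*} [MeasurableSpace α] {μ : Measure α}
    [IsProbabilityMeasure μ] {U : α → ℝ} (hU : Measurable U) {K : ℝ} (hK : ∀ᵐ x ∂μ, |U x| ≤ K)
    (hpos : 0 < ∫ x, U x ∂μ) :
    ∃ ε : ℝ, 0 < ε ∧ ε < 1 ∧ ∫⁻ x, ENNReal.ofReal (Real.exp (-ε * U x)) ∂μ < 1 := by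
  have hint : Integrable U μ := Integrable.of_bound hU.aestronglyMeasurable K hK
  set e := ∫ x, U x ∂μ with he
  have hK0 : 0 ≤ K := by
    obtain ⟨x, hx⟩ := hK.exists
    exact (abs_nonneg _).trans hx
  -- A small `ε` makes `(ε * K) ^ 2`, the error of the linear approximation, smaller than `ε * e`.
  set ε := min (1 / (2 * (K + 1))) (e / (2 * (K + 1) ^ 2))
  have hε0 : 0 < ε := lt_min (by positivity) (by positivity)
  have h1 : ε * (K + 1) ≤ 1 / 2 := by
    calc ε * (K + 1) ≤ 1 / (2 * (K + 1)) * (K + 1) :=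
          mul_le_mul_of_nonneg_right (min_le_left _ _) (by positivity)
      _ = 1 / 2 := by field_simp
  have h2 : ε * (K + 1) ^ 2 ≤ e / 2 := by
    calc ε * (K + 1) ^ 2 ≤ e / (2 * (K + 1) ^ 2) * (K + 1) ^ 2 :=
          mul_le_mul_of_nonneg_right (min_le_right _ _) (by positivity)
      _ = e / 2 := by field_simp
  refine ⟨ε, hε0, by nlinarith, ?_⟩
  have hbd : ∀ᵐ x ∂μ, Real.exp (-ε * U x) ≤ 1 - ε * U x + (ε * K) ^ 2 := by
    filter_upwards [hK] with x hx
    have hle : |-ε * U x| ≤ ε * K := by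
      rw [abs_mul, abs_neg, abs_of_pos hε0]
      exact mul_le_mul_of_nonneg_left hx hε0.le
    have := (abs_le.1 (Real.abs_exp_sub_one_sub_id_le (x := -ε * U x) (by nlinarith))).2
    have hsq : (-ε * U x) ^ 2 ≤ (ε * K) ^ 2 := by
      rw [← sq_abs (-ε * U x)]
      exact pow_le_pow_left₀ (abs_nonneg _) hle 2
    linarith
  have hmaj : Integrable (fun x => 1 - ε * U x + (ε * K) ^ 2) μ :=
    ((integrable_const _).sub (hint.const_mul ε)).add (integrable_const _)
  have hexp : Integrable (fun x => Real.exp (-ε * U x)) μ :=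
    hmaj.mono' ((hU.const_mul _).exp).aestronglyMeasurable (by
      filter_upwards [hbd] with x hx
      rwa [Real.norm_eq_abs, abs_of_pos (Real.exp_pos _)])
  rw [← ofReal_integral_eq_lintegral_ofReal hexp (ae_of_all _ fun x => (Real.exp_pos _).le),
    ENNReal.ofReal_lt_one]
  calc ∫ x, Real.exp (-ε * U x) ∂μ ≤ ∫ x, (1 - ε * U x + (ε * K) ^ 2) ∂μ :=
        integral_mono_ae hexp hmaj hbd
    _ = 1 - ε * e + (ε * K) ^ 2 := by
        have h4 : Integrable (fun x => ε * U x) μ := hint.const_mul ε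
        have h5 : Integrable (fun x => 1 - ε * U x) μ := (integrable_const _).sub h4
        rw [integral_add h5 (integrable_const _), integral_sub (integrable_const _) h4,
          integral_const_mul]
        simp [he]
    _ < 1 := by
        have h3 : ε * K ^ 2 ≤ e / 2 := h2.trans' (by
          refine mul_le_mul_of_nonneg_left ?_ hε0.le
          nlinarith)
        nlinarith [mul_le_mul_of_nonneg_left h3 hε0.le, mul_pos hε0 hpos]

/-- Chebyshev's inequality for the total truncated offspring of `z` individuals. -/
lemma measure_sum_min_lt_le {M z : ℕ} (hz : 1 ≤ z) (q : Env) {κ c : ℝ} (hκ : 0 < κ) (hc : c < 1)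
    (hq : κ ≤ truncMean M q) :
    Measure.pi (fun _ : Fin z => (q.1 : Measure ℕ))
        {p | ∑ i, ((min (p i) M : ℕ) : ℝ) < c * truncMean M q * z} ≤
      ENNReal.ofReal ((M / ((1 - c) * κ)) ^ 2 / z) := by
  have hz' : (0 : ℝ) < z := by exact_mod_cast hz
  have hL : ∀ _ : Fin z, MemLp (fun j : ℕ => ((min j M : ℕ) : ℝ)) 2 (q.1 : Measure ℕ) := fun _ =>
    MemLp.of_bound (measurable_of_countable _).aestronglyMeasurable (M : ℝ)
      (ae_of_all _ fun j => norm_cast_min_le j M)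
  set π := Measure.pi (fun _ : Fin z => (q.1 : Measure ℕ))
  set X : (Fin z → ℕ) → ℝ := ∑ i, fun p => ((min (p i) M : ℕ) : ℝ) with hX
  have hXp : ∀ p, X p = ∑ i, ((min (p i) M : ℕ) : ℝ) := fun p => by simp [hX]
  have hLi : ∀ i : Fin z, MemLp (fun p : Fin z → ℕ => ((min (p i) M : ℕ) : ℝ)) 2 π := fun i =>
    (hL i).comp_measurePreserving (measurePreserving_eval _ i)
  have hXL : MemLp X 2 π := memLp_finsetSum' _ fun i _ => hLi i
  have hmean : π[X] = z * truncMean M q := by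
    simp_rw [hXp]
    rw [integral_finsetSum _ fun i _ => (hLi i).integrable (by norm_num)]
    have : ∀ i : Fin z, ∫ p, ((min (p i) M : ℕ) : ℝ) ∂π = truncMean M q := fun i =>
      integral_comp_eval (μ := fun _ : Fin z => (q.1 : Measure ℕ))
        (f := fun j : ℕ => ((min j M : ℕ) : ℝ))
        (measurable_of_countable _).aestronglyMeasurable
    simp_rw [this]
    simp
  have hvar : variance X π ≤ z * (M : ℝ) ^ 2 := by
    have h1 : variance X π = ∑ _ : Fin z, variance (fun j : ℕ => ((min j M : ℕ) : ℝ))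
        (q.1 : Measure ℕ) := by
      exact variance_sum_pi (μ := fun _ : Fin z => (q.1 : Measure ℕ))
        (X := fun _ j => ((min j M : ℕ) : ℝ)) hL
    rw [h1]
    have h2 : variance (fun j : ℕ => ((min j M : ℕ) : ℝ)) (q.1 : Measure ℕ) ≤ (M : ℝ) ^ 2 := by
      have := variance_le_sq_of_bounded (μ := (q.1 : Measure ℕ)) (a := 0) (b := M)
        (X := fun j : ℕ => ((min j M : ℕ) : ℝ)) (ae_of_all _ fun j =>
          ⟨Nat.cast_nonneg _, Nat.cast_le.2 (min_le_right j M)⟩)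
        (measurable_of_countable _).aemeasurable
      nlinarith [sq_nonneg (M : ℝ)]
    simpa using mul_le_mul_of_nonneg_left h2 hz'.le
  have hd : 0 < (1 - c) * κ * z := by
    have : 0 < 1 - c := by linarith
    positivity
  calc π {p | ∑ i, ((min (p i) M : ℕ) : ℝ) < c * truncMean M q * z}
      ≤ π {p | (1 - c) * κ * z ≤ |X p - π[X]|} := by
        refine measure_mono fun p hp => ?_
        have hp' : X p < c * truncMean M q * z := by rw [hXp]; exact hp
        refine le_trans ?_ (neg_le_abs (X p - ∫ p, X p ∂π))
        rw [hmean]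
        have : (1 - c) * κ * z ≤ (1 - c) * truncMean M q * z := by
          have : 0 ≤ 1 - c := by linarith
          gcongr
        linarith
    _ ≤ ENNReal.ofReal (variance X π / ((1 - c) * κ * z) ^ 2) :=
        meas_ge_le_variance_div_sq hXL hd
    _ ≤ ENNReal.ofReal ((M / ((1 - c) * κ)) ^ 2 / z) := by
        refine ENNReal.ofReal_le_ofReal ?_
        calc variance X π / ((1 - c) * κ * z) ^ 2 ≤ z * (M : ℝ) ^ 2 / ((1 - c) * κ * z) ^ 2 := by
              gcongr
          _ = (M / ((1 - c) * κ)) ^ 2 / z := by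
              have : (1 - c) * κ ≠ 0 := fun h0 => by simp [h0] at hd
              field_simp

/-! ### The potential and its drift -/

/-- The potential `z ↦ max 1 (z / b) ^ (-ε)`: it equals `1` up to the level `b` and then decays like
`z ^ (-ε)`. -/
noncomputable def potential (b ε : ℝ) (z : ℕ) : ℝ≥0∞ :=
  ENNReal.ofReal ((max 1 ((z : ℝ) / b)) ^ (-ε))

lemma potential_le_one {b ε : ℝ} (hε : 0 < ε) (z : ℕ) : potential b ε z ≤ 1 := by
  rw [potential, ENNReal.ofReal_le_one]
  exact Real.rpow_le_one_of_one_le_of_nonpos (le_max_left _ _) (by linarith)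

lemma potential_eq {b ε : ℝ} (hb : 0 < b) {z : ℕ} (hz : b ≤ z) :
    potential b ε z = ENNReal.ofReal (((z : ℝ) / b) ^ (-ε)) := by
  rw [potential, max_eq_right ((one_le_div hb).2 hz)]

lemma potential_lt_one {b ε : ℝ} (hb : 0 < b) (hε : 0 < ε) {z : ℕ} (hz : b < z) :
    potential b ε z < 1 := by
  rw [potential_eq hb hz.le, ENNReal.ofReal_lt_one]
  exact Real.rpow_lt_one_of_one_lt_of_neg ((one_lt_div hb).2 hz) (by linarith)

/-- One step from a level `z ≥ b` in a fixed environment. Unless the truncated offspring is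
abnormally small, the population is multiplied by at least `c * truncMean M q`; the exceptional
event has probability `O(1 / z)`, while it raises the potential by a factor of at most `z ^ ε`. -/
lemma lintegral_stepLaw_potential_le {M z : ℕ} (q : Env) {b ε κ c : ℝ} (hb : 1 ≤ b) (hz : b ≤ z)
    (hε : 0 < ε) (hκ : 0 < κ) (hc0 : 0 < c) (hc : c < 1) (hq : κ ≤ truncMean M q) :
    ∫⁻ j, potential b ε j ∂(stepLaw q z) ≤ potential b ε z *
      (ENNReal.ofReal (Real.exp (-ε * (Real.log c + Real.log (truncMean M q)))) +
        ENNReal.ofReal ((z : ℝ) ^ ε * ((M / ((1 - c) * κ)) ^ 2 / z))) := by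
  have hb0 : 0 < b := by linarith
  have hz0 : (0 : ℝ) < z := by linarith
  have hz1 : 1 ≤ z := by exact_mod_cast hb.trans hz
  have hm : 0 < truncMean M q := hκ.trans_le hq
  set π := Measure.pi (fun _ : Fin z => (q.1 : Measure ℕ))
  set B : Set (Fin z → ℕ) := {p | ∑ i, ((min (p i) M : ℕ) : ℝ) < c * truncMean M q * z}
  set G : ℝ≥0∞ := ENNReal.ofReal (Real.exp (-ε * (Real.log c + Real.log (truncMean M q)))) with hG
  have hpt : ∀ p : (Fin z → ℕ) × ℕ, potential b ε ((∑ i, p.1 i) + p.2) ≤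
      potential b ε z * (G + ENNReal.ofReal ((z : ℝ) ^ ε) *
        (Prod.fst ⁻¹' B).indicator (fun _ => (1 : ℝ≥0∞)) p) := by
    intro p
    by_cases hp : p ∈ Prod.fst ⁻¹' B
    · rw [Set.indicator_of_mem hp, mul_one]
      refine (potential_le_one hε _).trans ?_
      refine le_trans ?_ (mul_le_mul_right (le_add_left le_rfl) _)
      rw [potential_eq hb0 hz, ← ENNReal.ofReal_mul (by positivity), ENNReal.one_le_ofReal,
        Real.div_rpow hz0.le hb0.le, Real.rpow_neg hz0.le, Real.rpow_neg hb0.le]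
      have h1 : 0 < (z : ℝ) ^ ε := Real.rpow_pos_of_pos hz0 ε
      have h2 : 1 ≤ b ^ ε := Real.one_le_rpow hb hε.le
      calc (1 : ℝ) ≤ b ^ ε := h2
        _ = ((z : ℝ) ^ ε)⁻¹ / (b ^ ε)⁻¹ * (z : ℝ) ^ ε := by
          have : b ^ ε ≠ 0 := by positivity
          field_simp
    · rw [Set.indicator_of_notMem hp, mul_zero, add_zero]
      have hp' : c * truncMean M q * z ≤ ∑ i, ((min (p.1 i) M : ℕ) : ℝ) := not_lt.1 hp
      have hle : c * truncMean M q * z ≤ (((∑ i, p.1 i) + p.2 : ℕ) : ℝ) := by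
        refine hp'.trans ?_
        rw [← Nat.cast_sum]
        exact Nat.cast_le.2 (le_add_right (Finset.sum_le_sum fun i _ => min_le_left _ _))
      rw [potential_eq hb0 hz, hG, ← ENNReal.ofReal_mul (by positivity), potential]
      refine ENNReal.ofReal_le_ofReal ?_
      have hcm : 0 < c * truncMean M q := mul_pos hc0 hm
      calc (max 1 ((((∑ i, p.1 i) + p.2 : ℕ) : ℝ) / b)) ^ (-ε)
          ≤ (z / b * (c * truncMean M q)) ^ (-ε) := by
            refine Real.rpow_le_rpow_of_nonpos (by positivity) ?_ (by linarith)
            refine le_trans ?_ (le_max_right _ _)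
            rw [div_mul_eq_mul_div]
            refine div_le_div_of_nonneg_right ?_ hb0.le
            linarith
        _ = (z / b : ℝ) ^ (-ε) * (c * truncMean M q) ^ (-ε) :=
            Real.mul_rpow (by positivity) hcm.le
        _ = (z / b : ℝ) ^ (-ε) *
              Real.exp (-ε * (Real.log c + Real.log (truncMean M q))) := by
            rw [Real.rpow_def_of_pos hcm, Real.log_mul hc0.ne' hm.ne', mul_comm (-ε)]
  have hBm : MeasurableSet (Prod.fst ⁻¹' B : Set ((Fin z → ℕ) × ℕ)) := .of_discrete
  calc ∫⁻ j, potential b ε j ∂(stepLaw q z)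
      = ∫⁻ p, potential b ε ((∑ i, p.1 i) + p.2) ∂(π.prod (q.2 : Measure ℕ)) :=
        lintegral_map (measurable_of_countable _) (measurable_of_countable _)
    _ ≤ ∫⁻ p, potential b ε z * (G + ENNReal.ofReal ((z : ℝ) ^ ε) *
          (Prod.fst ⁻¹' B).indicator (fun _ => (1 : ℝ≥0∞)) p) ∂(π.prod (q.2 : Measure ℕ)) :=
        lintegral_mono hpt
    _ = potential b ε z * (G + ENNReal.ofReal ((z : ℝ) ^ ε) * π B) := by
        rw [lintegral_const_mul _ (measurable_of_countable _), lintegral_add_left measurable_const,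
          lintegral_const, measure_univ, mul_one,
          lintegral_const_mul _ (measurable_of_countable _), lintegral_indicator hBm, lintegral_one,
          Measure.restrict_apply_univ,
          measurePreserving_fst.measure_preimage (MeasurableSet.of_discrete).nullMeasurableSet]
    _ ≤ _ := by
        rw [ENNReal.ofReal_mul (by positivity)]
        gcongr
        exact measure_sum_min_lt_le hz1 q hκ hc hq

/-- The potential contracts in mean above the level `b`, for suitable `ε` and `b`. -/
lemma Supercritical.exists_potential_drift {ν : Measure Env} [IsProbabilityMeasure ν]
    (hν : Supercritical ν) (hB : AssumptionB ν) :
    ∃ (b : ℕ) (ε : ℝ) (ρ : ℝ≥0∞), 1 ≤ b ∧ 0 < ε ∧ ε < 1 ∧ ρ < 1 ∧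
      ∀ z : ℕ, b ≤ z → transition ν (potential b ε) z ≤ ρ * potential b ε z := by
  obtain ⟨δ, -, hδ1, hδ⟩ := hB
  obtain ⟨M, hM1, hM⟩ := hν.exists_truncMean hδ1 hδ
  have hκ : 0 < 1 - δ := by linarith
  have hge : ∀ᵐ q ∂ν, 1 - δ ≤ truncMean M q := by
    filter_upwards [hδ] with q hq
    linarith [one_sub_measure_zero_le_truncMean hM1 q]
  have hbd : ∀ᵐ q ∂ν, |Real.log (truncMean M q)| ≤ |Real.log (1 - δ)| + |Real.log M| := by
    filter_upwards [hge] with q hq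
    have h1 := Real.log_le_log hκ hq
    have h2 := Real.log_le_log (hκ.trans_le hq) (truncMean_le M q)
    rw [abs_le]
    constructor
    · linarith [neg_abs_le (Real.log (1 - δ)), abs_nonneg (Real.log M)]
    · linarith [le_abs_self (Real.log M), abs_nonneg (Real.log (1 - δ))]
  -- A growth by the factor `c * truncMean M q` instead of `truncMean M q` is still supercritical.
  set e := ∫ q, Real.log (truncMean M q) ∂ν
  set c := Real.exp (-(e / 2)) with hc
  have hc1 : c < 1 := by
    rw [hc, Real.exp_lt_one_iff]
    linarith
  have hint : Integrable (fun q => Real.log (truncMean M q)) ν :=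
    Integrable.of_bound (measurable_truncMean M).log.aestronglyMeasurable _ hbd
  obtain ⟨ε, hε0, hε1, hε⟩ := exists_lintegral_exp_lt_one (μ := ν)
    (U := fun q => Real.log c + Real.log (truncMean M q))
    ((measurable_truncMean M).log.const_add _)
    (K := |Real.log c| + (|Real.log (1 - δ)| + |Real.log M|))
    (by
      filter_upwards [hbd] with q hq
      exact (abs_add_le _ _).trans (by gcongr))
    (by
      rw [integral_add (integrable_const _) hint]
      simp only [hc, Real.log_exp, integral_const, probReal_univ, one_smul]
      linarith)
  set E := ∫⁻ q, ENNReal.ofReal (Real.exp (-ε * (Real.log c + Real.log (truncMean M q)))) ∂ν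
    with hE
  set D := (M / ((1 - c) * (1 - δ))) ^ 2
  -- The contribution of the exceptional event vanishes at high levels.
  have hlim : Filter.Tendsto (fun z : ℕ => E + ENNReal.ofReal ((z : ℝ) ^ ε * (D / z)))
      Filter.atTop (nhds (E + ENNReal.ofReal 0)) := by
    refine tendsto_const_nhds.add (ENNReal.tendsto_ofReal ?_)
    have h1 : Filter.Tendsto (fun z : ℕ => D * (z : ℝ) ^ (-(1 - ε))) Filter.atTop (nhds (D * 0)) :=
      ((tendsto_rpow_neg_atTop (by linarith)).comp tendsto_natCast_atTop_atTop).const_mul D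
    rw [mul_zero] at h1
    refine h1.congr' ?_
    filter_upwards [Filter.eventually_gt_atTop 0] with z hz
    have hz' : (0 : ℝ) < z := by exact_mod_cast hz
    rw [neg_sub, Real.rpow_sub_one hz'.ne']
    ring
  obtain ⟨ρ, hEρ, hρ⟩ := exists_between hε
  rw [ENNReal.ofReal_zero, add_zero] at hlim
  obtain ⟨b, hb⟩ := Filter.eventually_atTop.1 (hlim.eventually (gt_mem_nhds hEρ))
  refine ⟨max b 1, ε, ρ, le_max_right _ _, hε0, hε1, hρ, fun z hz => ?_⟩
  have hb1 : (1 : ℝ) ≤ (max b 1 : ℕ) := by exact_mod_cast le_max_right b 1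
  calc transition ν (potential (max b 1 : ℕ) ε) z
      ≤ ∫⁻ q, potential (max b 1 : ℕ) ε z *
          (ENNReal.ofReal (Real.exp (-ε * (Real.log c + Real.log (truncMean M q)))) +
            ENNReal.ofReal ((z : ℝ) ^ ε * (D / z))) ∂ν := by
        refine lintegral_mono_ae ?_
        filter_upwards [hge] with q hq
        exact lintegral_stepLaw_potential_le q hb1 (by exact_mod_cast hz) hε0 hκ
          (Real.exp_pos _) hc1 hq
    _ = potential (max b 1 : ℕ) ε z * (E + ENNReal.ofReal ((z : ℝ) ^ ε * (D / z))) := by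
        have hm : Measurable fun q =>
            ENNReal.ofReal (Real.exp (-ε * (Real.log c + Real.log (truncMean M q)))) :=
          (((measurable_truncMean M).log.const_add _).const_mul _).exp.ennreal_ofReal
        rw [lintegral_const_mul _ (hm.add_const _), lintegral_add_right _ measurable_const]
        simp [hE]
    _ ≤ ρ * potential (max b 1 : ℕ) ε z := by
        rw [mul_comm ρ]
        gcongr
        exact (hb z ((le_max_left b 1).trans hz)).le

/-! ### Escape from low levels -/

lemma lintegral_lt_one_of_le_one {α : Type*} [MeasurableSpace α] {μ : Measure α}
    [IsProbabilityMeasure μ] {F : α → ℝ≥0∞} (h1 : ∀ x, F x ≤ 1)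
    (hpos : μ {x | F x < 1} ≠ 0) : ∫⁻ x, F x ∂μ < 1 := by
  calc ∫⁻ x, F x ∂μ < ∫⁻ _, 1 ∂μ :=
        lintegral_strict_mono_of_ae_le_of_ae_lt_on (s := {x | F x < 1})
          measurable_const.aemeasurable
          (ne_top_of_le_ne_top (by simp) (lintegral_mono h1)) (ae_of_all _ h1) hpos
          (ae_of_all _ fun x hx => hx)
    _ = 1 := by simp

lemma transition_le_one {ν : Measure Env} [IsProbabilityMeasure ν] {U : ℕ → ℝ≥0∞}
    (hU : ∀ z, U z ≤ 1) (z : ℕ) : transition ν U z ≤ 1 := by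
  calc transition ν U z ≤ ∫⁻ _, ∫⁻ _, 1 ∂(stepLaw _ z) ∂ν :=
        lintegral_mono fun q => lintegral_mono hU
    _ = 1 := by simp

lemma transition_lt_one {ν : Measure Env} [IsProbabilityMeasure ν] {U : ℕ → ℝ≥0∞}
    (hU : ∀ z, U z ≤ 1) {z s : ℕ} (hs : ∀ j, s ≤ j → U j < 1)
    (hpos : ν {q | stepLaw q z (Set.Ici s) ≠ 0} ≠ 0) : transition ν U z < 1 := by
  refine lintegral_lt_one_of_le_one (fun q => ?_)
    fun h0 => hpos (measure_mono_null (fun q hq => ?_) h0)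
  · calc ∫⁻ j, U j ∂(stepLaw q z) ≤ ∫⁻ _, 1 ∂(stepLaw q z) := lintegral_mono hU
      _ = 1 := by simp
  · refine lintegral_lt_one_of_le_one hU fun h1 => hq ?_
    exact measure_mono_null (fun j hj => hs j hj) h1

lemma stepLaw_Ici_one_ne_zero {q : Env} (hq : (q.2 : Measure ℕ) {0} < 1) (z : ℕ) :
    stepLaw q z (Set.Ici 1) ≠ 0 := by
  rw [stepLaw_apply]
  intro h0
  have h1 := measure_mono_null (s := Set.univ ×ˢ {0}ᶜ) (fun p hp => ?_) h0
  · rw [Measure.prod_prod, measure_univ, one_mul, prob_compl_eq_zero_iff .of_discrete] at h1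
    exact hq.ne h1
  · have : p.2 ≠ 0 := hp.2
    simp only [Set.mem_ofPred_eq, Set.mem_Ici]
    omega

lemma stepLaw_Ici_succ_ne_zero {q : Env} (hq : (q.1 : Measure ℕ) (Set.Ici 2) ≠ 0) {z : ℕ}
    (hz : 1 ≤ z) : stepLaw q z (Set.Ici (z + 1)) ≠ 0 := by
  rw [stepLaw_apply]
  intro h0
  have h1 := measure_mono_null (s := (Set.univ.pi fun _ => Set.Ici 2) ×ˢ Set.univ)
    (fun p hp => ?_) h0
  · rw [Measure.prod_prod, measure_univ, mul_one, Measure.pi_pi, Finset.prod_const] at h1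
    exact hq (by simpa [show z ≠ 0 by omega] using h1)
  · have h2 : ∀ i, 2 ≤ p.1 i := fun i => hp.1 i (Set.mem_univ i)
    have h3 : ∑ _i : Fin z, 2 ≤ ∑ i, p.1 i := Finset.sum_le_sum fun i _ => h2 i
    simp only [Finset.sum_const, Finset.card_univ, Fintype.card_fin, smul_eq_mul] at h3
    simp only [Set.mem_ofPred_eq, Set.mem_Ici]
    omega

/-- If an individual had at most one child almost surely, `log m(f)` could not have positive
mean. -/
lemma Supercritical.measure_Ici_two_ne_zero {ν : Measure Env} (hν : Supercritical ν) :
    ν {q | (q.1 : Measure ℕ) (Set.Ici 2) ≠ 0} ≠ 0 := by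
  intro h0
  have hae : ∀ᵐ q ∂ν, (q.1 : Measure ℕ) (Set.Ici 2) = 0 := h0
  refine hν.integral_logMean_pos.not_ge (integral_nonpos_of_ae ?_)
  filter_upwards [hae] with q hq
  refine Real.log_nonpos ENNReal.toReal_nonneg ?_
  refine ENNReal.toReal_le_of_le_ofReal zero_le_one ?_
  rw [mean_eq_lintegral, ENNReal.ofReal_one]
  calc ∫⁻ j, (j : ℝ≥0∞) ∂(q.1 : Measure ℕ) ≤ ∫⁻ _, 1 ∂(q.1 : Measure ℕ) := by
        refine lintegral_mono_ae ?_
        have : ∀ᵐ j ∂(q.1 : Measure ℕ), j ∉ Set.Ici 2 := measure_eq_zero_iff_ae_notMem.1 hq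
        filter_upwards [this] with j hj
        have hj' : j ≤ 1 := by
          simp only [Set.mem_Ici, not_le] at hj
          omega
        exact_mod_cast hj'
    _ = 1 := by simp

/-- From every state the annealed process is above any level `b` after `b + 1` steps with positive
probability: an immigrant arrives, and from then on every individual has at least two children. -/
lemma Supercritical.iterate_transition_lt_one {ν : Measure Env} [IsProbabilityMeasure ν]
    (hν : Supercritical ν) {U : ℕ → ℝ≥0∞} (hU : ∀ z, U z ≤ 1) {b : ℕ}
    (hb : ∀ z, b < z → U z < 1) (z : ℕ) : (transition ν)^[b + 1] U z < 1 := by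
  induction b generalizing U with
  | zero =>
    refine transition_lt_one hU (s := 1) (fun j hj => hb j hj) fun h0 => hν.immigration.ne' ?_
    exact measure_mono_null (fun q hq => stepLaw_Ici_one_ne_zero hq z) h0
  | succ b ih =>
    rw [Function.iterate_succ_apply]
    refine ih (transition_le_one hU) fun y hy => ?_
    refine transition_lt_one hU (s := y + 1) (fun j hj => hb j (by omega)) fun h0 =>
      hν.measure_Ici_two_ne_zero ?_
    exact measure_mono_null (fun q hq => stepLaw_Ici_succ_ne_zero hq (by omega)) h0

/-! ### Exponential decay -/

lemma iterate_transition_le {ν : Measure Env} {V : ℕ → ℝ≥0∞} (hV : transition ν V ≤ V) (m : ℕ) :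
    (transition ν)^[m] V ≤ V := by
  induction m with
  | zero => exact le_rfl
  | succ m ih =>
    rw [Function.iterate_succ_apply']
    exact (transition_mono ν ih).trans hV

/-- After `b + 1` steps the potential contracts in mean from every state: above `b` by its drift,
and at the finitely many states below `b` because the level `b` is exceeded with positive
probability. -/
lemma Supercritical.exists_potential_contraction {ν : Measure Env} [IsProbabilityMeasure ν]
    (hν : Supercritical ν) (hB : AssumptionB ν) :
    ∃ (b L : ℕ) (ε : ℝ) (ρ : ℝ≥0∞), 1 ≤ b ∧ 1 ≤ L ∧ 0 < ε ∧ ε < 1 ∧ ρ < 1 ∧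
      (transition ν)^[L] (potential b ε) ≤ fun z => ρ * potential b ε z := by
  obtain ⟨b, ε, ρ, hb, hε0, hε1, hρ, hdrift⟩ := hν.exists_potential_drift hB
  have hb0 : (0 : ℝ) < b := by exact_mod_cast hb
  have hsuper : transition ν (potential b ε) ≤ potential b ε := fun z => by
    rcases le_or_gt b z with hz | hz
    · exact (hdrift z hz).trans (mul_le_of_le_one_left zero_le hρ.le)
    · have h1 : potential b ε z = 1 := by
        have : (z : ℝ) / b ≤ 1 := (div_le_one hb0).2 (by exact_mod_cast hz.le)
        simp [potential, max_eq_left this]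
      rw [h1]
      exact transition_le_one (potential_le_one hε0) z
  set W := (transition ν)^[b + 1] (potential b ε) with hW
  have hWlt : ∀ z, W z < 1 := hν.iterate_transition_lt_one (potential_le_one hε0)
    fun z hz => potential_lt_one hb0 hε0 (by exact_mod_cast hz)
  refine ⟨b, b + 1, ε, max ρ ((Finset.range b).sup W), hb, by omega, hε0, hε1,
    max_lt hρ ((Finset.sup_lt_iff (by simp)).2 fun z _ => hWlt z), fun z => ?_⟩
  rcases le_or_gt b z with hz | hz
  · calc W z = (transition ν) ((transition ν)^[b] (potential b ε)) z := by
          rw [hW, Function.iterate_succ_apply']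
      _ ≤ transition ν (potential b ε) z := transition_mono ν (iterate_transition_le hsuper b) z
      _ ≤ ρ * potential b ε z := hdrift z hz
      _ ≤ _ := mul_le_mul_left (le_max_left _ _) _
  · have h1 : potential b ε z = 1 := by
      have : (z : ℝ) / b ≤ 1 := (div_le_one hb0).2 (by exact_mod_cast hz.le)
      simp [potential, max_eq_left this]
    simp only [h1, mul_one]
    exact (Finset.le_sup (f := W) (Finset.mem_range.2 hz)).trans (le_max_right _ _)

lemma IsBPIRE.lintegral_le_pow {Ω : Type*} [MeasurableSpace Ω] {P : Measure Ω}
    [IsProbabilityMeasure P] {ν : Measure Env} {k : ℕ} {ξ : ℕ → Ω → Env} {Z : ℕ → Ω → ℕ}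
    (h : IsBPIRE P ν k ξ Z) {V : ℕ → ℝ≥0∞} (hV1 : ∀ z, V z ≤ 1) {L : ℕ} {ρ : ℝ≥0∞}
    (hL : (transition ν)^[L] V ≤ fun z => ρ * V z) (n : ℕ) :
    ∫⁻ ω, V (Z n ω) ∂P ≤ ρ ^ (n / L) := by
  have hpow : ∀ i r : ℕ, ∫⁻ ω, V (Z (r + L * i) ω) ∂P ≤ ρ ^ i := by
    intro i r
    induction i with
    | zero =>
      calc ∫⁻ ω, V (Z (r + L * 0) ω) ∂P ≤ ∫⁻ _, 1 ∂P := lintegral_mono fun ω => hV1 _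
        _ = ρ ^ 0 := by simp
    | succ i ih =>
      rw [Nat.mul_succ, ← add_assoc, h.lintegral_add]
      calc ∫⁻ ω, (transition ν)^[L] V (Z (r + L * i) ω) ∂P
          ≤ ∫⁻ ω, ρ * V (Z (r + L * i) ω) ∂P := lintegral_mono fun ω => hL _
        _ = ρ * ∫⁻ ω, V (Z (r + L * i) ω) ∂P :=
            lintegral_const_mul _ ((measurable_of_countable V).comp (h.measurable_process _))
        _ ≤ ρ ^ (i + 1) := by
            rw [pow_succ']
            gcongr
  conv_lhs => rw [← Nat.mod_add_div n L]
  exact hpow (n / L) (n % L)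

end BPIRE

theorem theorem3p2 (ν : Measure BPIRE.Env) [IsProbabilityMeasure ν]
    (hν : BPIRE.Supercritical ν) (hA : BPIRE.AssumptionA ν) (hB : BPIRE.AssumptionB ν) :
    ∃ θ β C : ℝ, 0 < θ ∧ θ < ∫ q, BPIRE.logMean q ∂ν ∧ 0 < β ∧ 0 < C ∧
      ∀ (k : ℕ), 1 ≤ k →
      ∀ (Ω : Type*) [MeasurableSpace Ω] (P : Measure Ω) [IsProbabilityMeasure P]
        (ξ : ℕ → Ω → BPIRE.Env) (Z : ℕ → Ω → ℕ), BPIRE.IsBPIRE P ν k ξ Z →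
      ∀ n : ℕ, P.real {ω | 1 ≤ Z n ω ∧ (Z n ω : ℝ) ≤ Real.exp (θ * n)}
        ≤ C * Real.exp (-β * n) := by
  obtain ⟨b, L, ε, ρ₀, hb, hL, hε0, hε1, hρ₀, hcontr⟩ := hν.exists_potential_contraction hB
  have hb1 : (1 : ℝ) ≤ b := by exact_mod_cast hb
  have hL0 : (0 : ℝ) < L := by exact_mod_cast hL
  -- A positive real rate is needed to take logarithms.
  obtain ⟨ρ, hρpos, hρ1, hρ⟩ : ∃ ρ : ℝ, 0 < ρ ∧ ρ < 1 ∧ ρ₀ ≤ ENNReal.ofReal ρ := by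
    obtain ⟨r, hr, hr1⟩ := ENNReal.lt_iff_exists_nnreal_btwn.1 hρ₀
    refine ⟨r, ?_, by exact_mod_cast hr1, by simpa using hr.le⟩
    have : (0 : ℝ≥0∞) < r := lt_of_le_of_lt zero_le hr
    exact_mod_cast this
  set γ := -Real.log ρ / L with hγ
  have hγ0 : 0 < γ := div_pos (neg_pos.2 (Real.log_neg hρpos hρ1)) hL0
  set μ := ∫ q, BPIRE.logMean q ∂ν
  have hμ0 : 0 < μ := hν.integral_logMean_pos
  refine ⟨min (γ / 2) (μ / 2), γ / 2, ρ⁻¹, by positivity,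
    (min_le_right _ _).trans_lt (by linarith), by positivity, by positivity, ?_⟩
  intro k _ Ω _ P _ ξ Z h n
  set θ := min (γ / 2) (μ / 2)
  have hθ0 : 0 < θ := by positivity
  have hθγ : θ ≤ γ / 2 := min_le_left _ _
  set a := Real.exp (-(ε * (θ * n))) with ha
  have ha0 : 0 < a := Real.exp_pos _
  have hn : (0 : ℝ) ≤ n := Nat.cast_nonneg n
  have hEV := h.lintegral_le_pow (BPIRE.potential_le_one hε0) hcontr n
  -- On the event in question the potential is at least `exp (-ε θ n)`.
  have hsub : {ω | 1 ≤ Z n ω ∧ (Z n ω : ℝ) ≤ Real.exp (θ * n)} ⊆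
      {ω | ENNReal.ofReal a ≤ BPIRE.potential b ε (Z n ω)} := by
    intro ω hω
    refine ENNReal.ofReal_le_ofReal ?_
    have h1 : max 1 ((Z n ω : ℝ) / b) ≤ Real.exp (θ * n) :=
      max_le (Real.one_le_exp (by positivity))
        ((div_le_self (Nat.cast_nonneg _) hb1).trans hω.2)
    calc a = Real.exp (θ * n) ^ (-ε) := by
          rw [← Real.exp_mul, ha]
          ring_nf
      _ ≤ _ := Real.rpow_le_rpow_of_nonpos (by positivity) h1 (by linarith)
  have hmarkov : ENNReal.ofReal a * P {ω | 1 ≤ Z n ω ∧ (Z n ω : ℝ) ≤ Real.exp (θ * n)} ≤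
      ENNReal.ofReal (ρ ^ (n / L)) := by
    calc _ ≤ ENNReal.ofReal a * P {ω | ENNReal.ofReal a ≤ BPIRE.potential b ε (Z n ω)} := by
          gcongr
      _ ≤ ∫⁻ ω, BPIRE.potential b ε (Z n ω) ∂P :=
          mul_meas_ge_le_lintegral
            ((measurable_of_countable (BPIRE.potential b ε)).comp (h.measurable_process n)) _
      _ ≤ ρ₀ ^ (n / L) := hEV
      _ ≤ ENNReal.ofReal ρ ^ (n / L) := by gcongr
      _ = ENNReal.ofReal (ρ ^ (n / L)) := (ENNReal.ofReal_pow hρpos.le _).symm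
  have hreal : a * P.real {ω | 1 ≤ Z n ω ∧ (Z n ω : ℝ) ≤ Real.exp (θ * n)} ≤ ρ ^ (n / L) := by
    have := ENNReal.toReal_mono ENNReal.ofReal_ne_top hmarkov
    rwa [ENNReal.toReal_mul, ENNReal.toReal_ofReal ha0.le,
      ENNReal.toReal_ofReal (by positivity)] at this
  -- The integer part of `n / L` costs a factor `ρ⁻¹`.
  have hfloor : ρ ^ (n / L) ≤ ρ⁻¹ * Real.exp (-γ * n) := by
    have h1 : (n : ℝ) / L - 1 ≤ ((n / L : ℕ) : ℝ) := by
      have : n < L * (n / L + 1) := Nat.lt_mul_div_succ n hL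
      have h2 : (n : ℝ) < L * (((n / L : ℕ) : ℝ) + 1) := by exact_mod_cast this
      rw [sub_le_iff_le_add, div_le_iff₀ hL0]
      linarith
    calc ρ ^ (n / L) = ρ ^ ((n / L : ℕ) : ℝ) := (Real.rpow_natCast _ _).symm
      _ ≤ ρ ^ ((n : ℝ) / L - 1) := Real.rpow_le_rpow_of_exponent_ge hρpos hρ1.le h1
      _ = ρ⁻¹ * Real.exp (-γ * n) := by
          rw [Real.rpow_sub_one hρpos.ne', Real.rpow_def_of_pos hρpos, hγ, div_eq_inv_mul]
          congr 2
          ring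
  have hexp : Real.exp (-γ * n) ≤ a * Real.exp (-(γ / 2) * n) := by
    rw [ha, ← Real.exp_add]
    refine Real.exp_le_exp.2 ?_
    have h1 : ε * (θ * n) ≤ γ / 2 * n := by
      calc ε * (θ * n) ≤ 1 * (θ * n) := by gcongr
        _ ≤ γ / 2 * n := by
          rw [one_mul]
          gcongr
    linarith
  refine le_of_mul_le_mul_left ?_ ha0
  calc _ ≤ ρ⁻¹ * Real.exp (-γ * n) := hreal.trans hfloor
    _ ≤ ρ⁻¹ * (a * Real.exp (-(γ / 2) * n)) := by gcongr
    _ = a * (ρ⁻¹ * Real.exp (-(γ / 2) * n)) := by ring
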